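/- Let $K,A,B$ be finite nonempty sets (states, actions of player 1, actions of player 2). For each $k\in K$ let $M_k\in\mathbb{R}^{A\times B}$, and for each $a\in A$ let $Q_a\in\mathbb{R}^{K\times K}$ be a row-stochastic matrix. Write $\Delta(S)$ for the set of probability distributions on a finite set $S$. For $N\ge 1$ and $\alpha\in\mathbb{R}^K$ the $N$-stage dual game $G_N(\alpha)$ is the following zero-sum game. Player 1 (informed, maximizer) chooses the initial state $k_1$ by a distribution $p\in\Delta(K)$; at each later stage $t$, $k_t$ is drawn from $Q_{a_{t-1}}(k_{t-1},\cdot)$. States are observed by player 1 only. At each stage $t=1,\dots,N$ both players simultaneously choose actions $a_t\in A$ and $b_t\in B$, which both then observe. A strategy of player 1 is a pair $(p,\sigma)$ with $p\in\Delta(K)$ and $\sigma=(\sigma_t)_{t=1}^N$, $\sigma_t:K^t\times A^{t-1}\times B^{t-1}\to\Delta(A)$; a strategy of player 2 is $\tau=(\tau_t)_{t=1}^N$, $\tau_t:A^{t-1}\times B^{t-1}\to\Delta(B)$. The payoff to player 1 is $$g_N(\alpha,(p,\sigma),\tau)=\mathbf{E}_{p,\sigma,\tau,Q}\Big(\alpha(k_1)+\sum_{t=1}^N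 M_{k_t}(a_t,b_t)\Big).$$ Then, for every $N\ge1$ and $\alpha\in\mathbb{R}^K$, $G_N(\alpha)$ has a value $$w_N(\alpha)=\max_{(p,\sigma)}\min_{\tau}g_N(\alpha,(p,\sigma),\tau)=\min_{\tau}\max_{(p,\sigma)}g_N(\alpha,(p,\sigma),\tau),$$ and for every $n\ge 1$ and $\alpha\in\mathbb{R}^K$, $$w_{n+1}(\alpha)=\min_{\hat y\in\Delta(B)}\ \min_{(\beta_a)_{a\in A}\in(\mathbb{R}^{K})^A}\ \max_{\Pi\in\Delta(K\times A)}\ \sum_{k\in K,\,a\in A}\Pi(k,a)\Big(\sum_{b\in B}M_k(a,b)\hat y(b)+\alpha(k)-\sum_{k'\in K}Q_a(k,k')\beta_a(k')+w_n(\beta_a)\Big),$$ while $$w_1(\alpha)=\min_{\hat y\in\Delta(B)}\ \max_{\Pi\in\Delta(K\times A)}\ \sum_{k\in K,\,a\in A}\Pi(k,a)\Big(\sum_{b\in B}M_k(a,b)\hat y(b)+\alpha(k)\Big).$$ All the maxima and minima are attained. -/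

import Mathlib

namespace AsymGame

/-- `Δ(S)`, the set of probability distributions on a finite set `S`. -/
abbrev ProbDist (S : Type*) [Fintype S] : Type _ := ↥(stdSimplex ℝ S)

/-- `IsMaxOver R v` says that `v = max_x q(x)`, the maximum being attained, where `R x r` says that
the inner quantity `q(x)` is well defined with value `r`. -/
def IsMaxOver {X : Type*} (R : X → ℝ → Prop) (v : ℝ) : Prop :=
  ∃ q : X → ℝ, (∀ x, R x (q x)) ∧ IsGreatest (Set.range q) v

/-- `IsMinOver R v` says that `v = min_x q(x)`, the minimum being attained, where `R x r` says that
the inner quantity `q(x)` is well defined with value `r`. -/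
def IsMinOver {X : Type*} (R : X → ℝ → Prop) (v : ℝ) : Prop :=
  ∃ q : X → ℝ, (∀ x, R x (q x)) ∧ IsLeast (Set.range q) v

/-- The data of a zero-sum stochastic game controlled by player 1: the payoff matrices `M k`
and the transition matrices `Q a` (whose rows are probability distributions). -/
structure Game (K A B : Type*) [Fintype K] where
  M : K → Matrix A B ℝ
  Q : A → Matrix K K ℝ
  Q_mem : ∀ a k, Q a k ∈ stdSimplex ℝ K

/-- Behavior strategies of the informed player in the `N`-stage game. Stages are numbered from `0`;
at stage `t` the player has seen `t + 1` states, `t` own actions and `t` actions of player 2. -/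
abbrev Strategy₁ (K A B : Type*) [Fintype A] (N : ℕ) : Type _ :=
  ∀ t : Fin N, (Fin (t + 1) → K) → (Fin t → A) → (Fin t → B) → ProbDist A

/-- Behavior strategies of the uninformed player, who sees the actions but not the states. -/
abbrev Strategy₂ (A B : Type*) [Fintype B] (N : ℕ) : Type _ :=
  ∀ t : Fin N, (Fin t → A) → (Fin t → B) → ProbDist B

/-- A play of the `N`-stage game: the state and the two actions at every stage. -/
structure Play (K A B : Type*) (N : ℕ) where
  state : Fin N → K
  act₁ : Fin N → A
  act₂ : Fin N → B

/-- Plays are triples of finite sequences. -/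
def playEquiv (K A B : Type*) (N : ℕ) :
    Play K A B N ≃ (Fin N → K) × (Fin N → A) × (Fin N → B) where
  toFun h := (h.state, h.act₁, h.act₂)
  invFun x := ⟨x.1, x.2.1, x.2.2⟩
  left_inv _ := rfl
  right_inv _ := rfl

noncomputable instance {K A B : Type*} [Fintype K] [Fintype A] [Fintype B] {N : ℕ} :
    Fintype (Play K A B N) := by
  classical exact Fintype.ofEquiv _ (playEquiv K A B N).symm

namespace Game

variable {K A B : Type*} [Fintype K] [Fintype A] [Fintype B]

/-- The probability that the state at stage `t` is the one in the play `h`, given the past of `h`: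
the initial distribution `p` at the first stage, the transition law afterwards. -/
noncomputable def stateProb (G : Game K A B) {N : ℕ} (p : ProbDist K) (h : Play K A B N)
    (t : Fin N) : ℝ :=
  if (t : ℕ) = 0 then p.1 (h.state t)
  else
    let s : Fin N := ⟨t - 1, lt_of_le_of_lt (Nat.sub_le _ _) t.isLt⟩
    G.Q (h.act₁ s) (h.state s) (h.state t)

/-- The probability of the play `h` under the initial distribution `p` and the strategies
`σ`, `τ`. -/
noncomputable def playProb (G : Game K A B) {N : ℕ} (p : ProbDist K) (σ : Strategy₁ K A B N)
    (τ : Strategy₂ A B N) (h : Play K A B N) : ℝ :=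
  ∏ t : Fin N,
    let ks : Fin (t + 1) → K := fun i => h.state (Fin.castLE t.isLt i)
    let as : Fin t → A := fun i => h.act₁ (Fin.castLE t.isLt.le i)
    let bs : Fin t → B := fun i => h.act₂ (Fin.castLE t.isLt.le i)
    G.stateProb p h t * (σ t ks as bs).1 (h.act₁ t) * (τ t as bs).1 (h.act₂ t)

/-- The expected total payoff in the `N`-stage dual game with initial vector payoff `α`, where
player 1 draws the initial state from `p`:
the expectation of `α(k₁) + ∑ₜ M_{kₜ}(aₜ, bₜ)`. -/
noncomputable def dualPayoff (G : Game K A B) (N : ℕ) [NeZero N] (α : K → ℝ)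
    (s : ProbDist K × Strategy₁ K A B N) (τ : Strategy₂ A B N) : ℝ :=
  ∑ h : Play K A B N, G.playProb s.1 s.2 τ h *
    (α (h.state 0) + ∑ t : Fin N, G.M (h.state t) (h.act₁ t) (h.act₂ t))

/-- `v` is the value of the `N`-stage dual game: it is both the max-min and the min-max of the
payoff, all the maxima and minima being attained. -/
def IsDualValue (G : Game K A B) (N : ℕ) [NeZero N] (α : K → ℝ) (v : ℝ) : Prop :=
  IsMaxOver (fun s : ProbDist K × Strategy₁ K A B N =>
    IsMinOver fun (τ : Strategy₂ A B N) r => r = G.dualPayoff N α s τ) v ∧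
  IsMinOver (fun τ : Strategy₂ A B N =>
    IsMaxOver fun (s : ProbDist K × Strategy₁ K A B N) r => r = G.dualPayoff N α s τ) v

/-- `w_N(α)`, the value of the `N`-stage dual game with initial vector payoff `α`. -/
noncomputable def dualValue (G : Game K A B) (N : ℕ) [NeZero N] (α : K → ℝ) : ℝ :=
  ⨆ s : ProbDist K × Strategy₁ K A B N, ⨅ τ : Strategy₂ A B N, G.dualPayoff N α s τ

end Game

end AsymGame

open AsymGame

/-! To a strategy of player 2 belongs a reply vector (`bestGain`): the best payoff of player 1 in
each initial state. As player 1 picks the initial law, the strategy holds him in the dual game to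
the largest coordinate of `α` plus that vector. Everything rests on `w_N(α) ≤ r` iff some reply
vector is at most `r - α` coordinatewise (`dualValue_le_iff`).

For the value, the set of vectors dominating a reply vector is convex (`convex_achievable`), because
`b` does not affect transitions. Separating it from a negative orthant gives an optimal initial law
`p`; minimax one stage at a time then turns "every reply vector has `p`-average at least `v`" into a
single strategy guaranteeing `v` (`exists_forall_le_sum_mul_gain`).

For the recursion, player 2 may use a continuation depending only on `a`, so `w_{n+1}(α)` minimizes
the first-stage maximum over `y` and reply vectors `u_a`. By the criterion, `w_n(β) - β` always
dominates a reply vector, and `w_n(-u) ≤ 0` for each reply vector `u`; minimizing over `β_a` is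
therefore the same as minimizing over `u_a`. -/

namespace AsymGame

/-! ### Splitting strategies and plays at the first stage -/

/-- The first-stage mixed action of a strategy of player 1, as a function of the initial state. -/
def Strategy₁.first {K A B : Type*} [Fintype A] {n : ℕ} (σ : Strategy₁ K A B (n + 1)) (k : K) :
    ProbDist A :=
  σ 0 (fun _ => k) Fin.elim0 Fin.elim0

/-- The strategy of player 1 after the first stage, given what happened there. -/
def Strategy₁.tail {K A B : Type*} [Fintype A] {n : ℕ} (σ : Strategy₁ K A B (n + 1))
    (k : K) (a : A) (b : B) : Strategy₁ K A B n :=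
  fun t ks as bs => σ t.succ (Fin.cons k ks) (Fin.cons a as) (Fin.cons b bs)

/-- The strategy of player 1 with prescribed first stage and prescribed continuations. -/
def Strategy₁.cons {K A B : Type*} [Fintype A] {n : ℕ} (x : K → ProbDist A)
    (s : K → A → B → Strategy₁ K A B n) : Strategy₁ K A B (n + 1) :=
  Fin.cases (fun ks _ _ => x (ks 0)) fun t ks as bs =>
    s (ks 0) (as (0 : Fin (t + 1))) (bs (0 : Fin (t + 1))) t (fun i => ks i.succ)
      (fun i => as (Fin.succ i)) (fun i => bs (Fin.succ i))

/-- The first-stage mixed action of a strategy of player 2. -/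
def Strategy₂.first {A B : Type*} [Fintype B] {n : ℕ} (τ : Strategy₂ A B (n + 1)) : ProbDist B :=
  τ 0 Fin.elim0 Fin.elim0

/-- The strategy of player 2 after the first stage, given what happened there. -/
def Strategy₂.tail {A B : Type*} [Fintype B] {n : ℕ} (τ : Strategy₂ A B (n + 1))
    (a : A) (b : B) : Strategy₂ A B n :=
  fun t as bs => τ t.succ (Fin.cons a as) (Fin.cons b bs)

/-- The strategy of player 2 with prescribed first stage and prescribed continuations. -/
def Strategy₂.cons {A B : Type*} [Fintype B] {n : ℕ} (y : ProbDist B)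
    (s : A → B → Strategy₂ A B n) : Strategy₂ A B (n + 1) :=
  Fin.cases (fun _ _ => y) fun t as bs =>
    s (as (0 : Fin (t + 1))) (bs (0 : Fin (t + 1))) t
      (fun i => as (Fin.succ i)) (fun i => bs (Fin.succ i))

@[simp] theorem Strategy₁.first_cons {K A B : Type*} [Fintype A] {n : ℕ}
    (x : K → ProbDist A)
    (s : K → A → B → Strategy₁ K A B n) (k : K) : (Strategy₁.cons x s).first k = x k := rfl

@[simp] theorem Strategy₁.tail_cons {K A B : Type*} [Fintype A] {n : ℕ}
    (x : K → ProbDist A)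
    (s : K → A → B → Strategy₁ K A B n) (k : K) (a : A) (b : B) :
    (Strategy₁.cons x s).tail k a b = s k a b := rfl

@[simp] theorem Strategy₂.first_cons {A B : Type*} [Fintype B] {n : ℕ}
    (y : ProbDist B) (s : A → B → Strategy₂ A B n) :
    (Strategy₂.cons y s).first = y := rfl

@[simp] theorem Strategy₂.tail_cons {A B : Type*} [Fintype B] {n : ℕ}
    (y : ProbDist B) (s : A → B → Strategy₂ A B n) (a : A) (b : B) :
    (Strategy₂.cons y s).tail a b = s a b := rfl

theorem Strategy₂.continuous_first {A B : Type*} [Fintype B] {n : ℕ} :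
    Continuous (Strategy₂.first : Strategy₂ A B (n + 1) → ProbDist B) := by
  unfold Strategy₂.first
  fun_prop

theorem Strategy₂.continuous_tail {A B : Type*} [Fintype B] {n : ℕ} (a : A) (b : B) :
    Continuous fun τ : Strategy₂ A B (n + 1) => τ.tail a b := by
  unfold Strategy₂.tail
  fun_prop

/-- The play after the first stage. -/
def Play.tail {K A B : Type*} {n : ℕ} (h : Play K A B (n + 1)) : Play K A B n where
  state t := h.state t.succ
  act₁ t := h.act₁ t.succ
  act₂ t := h.act₂ t.succ

/-- A play consists of its first stage and its continuation. -/
def Play.consEquiv (K A B : Type*) (n : ℕ) :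
    (K × A × B) × Play K A B n ≃ Play K A B (n + 1) where
  toFun x := ⟨Fin.cons x.1.1 x.2.state, Fin.cons x.1.2.1 x.2.act₁, Fin.cons x.1.2.2 x.2.act₂⟩
  invFun h := ((h.state 0, h.act₁ 0, h.act₂ 0), h.tail)
  left_inv _ := rfl
  right_inv h := by
    cases h
    simp only [Play.tail, Play.mk.injEq]
    exact ⟨Fin.cons_self_tail _, Fin.cons_self_tail _, Fin.cons_self_tail _⟩

/-! ### The expected payoff as a recursion over stages -/

namespace Game

variable {K A B : Type*} [Fintype K] [Fintype A] [Fintype B] (G : Game K A B)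

theorem playProb_succ {n : ℕ} (p : ProbDist K) (σ : Strategy₁ K A B (n + 1))
    (τ : Strategy₂ A B (n + 1)) (h : Play K A B (n + 1)) :
    G.playProb p σ τ h =
      p.1 (h.state 0) * (σ.first (h.state 0)).1 (h.act₁ 0) * τ.first.1 (h.act₂ 0) *
      G.playProb ⟨G.Q (h.act₁ 0) (h.state 0), G.Q_mem _ _⟩
        (σ.tail (h.state 0) (h.act₁ 0) (h.act₂ 0)) (τ.tail (h.act₁ 0) (h.act₂ 0)) h.tail := by
  unfold playProb
  rw [Fin.prod_univ_succ]
  congr 1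
  · simp only [stateProb, Strategy₁.first, Strategy₂.first]
    refine congrArg₂ _ (congrArg₂ _ rfl (congrArg (fun x : ProbDist A => x.1 (h.act₁ 0)) ?_))
      (congrArg (fun x : ProbDist B => x.1 (h.act₂ 0)) ?_)
    · congr 1
      · funext i
        rw [Subsingleton.elim (α := Fin 1) i 0]
        rfl
      · exact funext fun i : Fin 0 => i.elim0
      · exact funext fun i : Fin 0 => i.elim0
    · congr 1
      · exact funext fun i : Fin 0 => i.elim0
      · exact funext fun i : Fin 0 => i.elim0
  · refine Finset.prod_congr rfl fun t _ => ?_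
    simp only [Strategy₁.tail, Strategy₂.tail]
    have hs : G.stateProb p h t.succ =
        G.stateProb ⟨G.Q (h.act₁ 0) (h.state 0), G.Q_mem _ _⟩ h.tail t := by
      -- At `t = 0` the initial law of the tail is the transition law out of the first stage.
      obtain ⟨t, ht⟩ := t
      cases t <;> rfl
    rw [hs]
    refine congrArg₂ _ (congrArg₂ _ rfl (congrArg (fun x : ProbDist A => x.1 (h.act₁ t.succ)) ?_))
      (congrArg (fun x : ProbDist B => x.1 (h.act₂ t.succ)) ?_)
    · congr 1
      · exact funext fun i => by cases i using Fin.cases <;> rfl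
      · exact funext fun i => by cases i using Fin.cases <;> rfl
      · exact funext fun i => by cases i using Fin.cases <;> rfl
    · congr 1
      · exact funext fun i => by cases i using Fin.cases <;> rfl
      · exact funext fun i => by cases i using Fin.cases <;> rfl

theorem sum_playProb_mul_succ {n : ℕ} (p : ProbDist K) (σ : Strategy₁ K A B (n + 1))
    (τ : Strategy₂ A B (n + 1)) (u : Play K A B (n + 1) → ℝ) :
    ∑ h, G.playProb p σ τ h * u h =
      ∑ k, p.1 k * ∑ a, (σ.first k).1 a * ∑ b, τ.first.1 b *
        ∑ h, G.playProb ⟨G.Q a k, G.Q_mem a k⟩ (σ.tail k a b) (τ.tail a b) h *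
          u (Play.consEquiv K A B n ((k, a, b), h)) := by
  rw [← (Play.consEquiv K A B n).sum_comp]
  simp only [Fintype.sum_prod_type, Finset.mul_sum, playProb_succ]
  refine Finset.sum_congr rfl fun k _ => Finset.sum_congr rfl fun a _ =>
    Finset.sum_congr rfl fun b _ => Finset.sum_congr rfl fun h _ => ?_
  rw [← mul_assoc, ← mul_assoc, ← mul_assoc]
  rfl

theorem sum_playProb (N : ℕ) (p : ProbDist K) (σ : Strategy₁ K A B N) (τ : Strategy₂ A B N) :
    ∑ h, G.playProb p σ τ h = 1 := by
  induction N generalizing p with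
  | zero =>
    rw [← (playEquiv K A B 0).symm.sum_comp]
    simp [playProb]
  | succ n ih =>
    have := G.sum_playProb_mul_succ p σ τ fun _ => 1
    simp only [mul_one, ih] at this
    rw [this, τ.first.2.2]
    simp only [mul_one, (σ.first _).2.2, p.2.2]

/-- The expected sum of the stage payoffs when the initial state is `k`. -/
noncomputable def gain : ∀ {N : ℕ}, Strategy₁ K A B N → Strategy₂ A B N → K → ℝ
  | 0, _, _, _ => 0
  | _ + 1, σ, τ, k => ∑ a, (σ.first k).1 a * ∑ b, τ.first.1 b *
      (G.M k a b + ∑ k', G.Q a k k' * gain (σ.tail k a b) (τ.tail a b) k')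

theorem sum_playProb_mul_payoff (N : ℕ) (p : ProbDist K) (σ : Strategy₁ K A B N)
    (τ : Strategy₂ A B N) :
    ∑ h, G.playProb p σ τ h * ∑ t, G.M (h.state t) (h.act₁ t) (h.act₂ t) =
      ∑ k, p.1 k * G.gain σ τ k := by
  induction N generalizing p with
  | zero => simp [gain]
  | succ n ih =>
    rw [sum_playProb_mul_succ]
    refine Finset.sum_congr rfl fun k _ => congrArg _ (Finset.sum_congr rfl fun a _ =>
      congrArg _ (Finset.sum_congr rfl fun b _ => congrArg _ ?_))
    simp only [Fin.sum_univ_succ, mul_add, Finset.sum_add_distrib]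
    congr 1
    · change ∑ h, G.playProb _ _ _ h * G.M k a b = G.M k a b
      rw [← Finset.sum_mul, sum_playProb, one_mul]
    · exact ih _ _ _

theorem dualPayoff_eq (N : ℕ) [NeZero N] (α : K → ℝ) (s : ProbDist K × Strategy₁ K A B N)
    (τ : Strategy₂ A B N) :
    G.dualPayoff N α s τ = ∑ k, s.1.1 k * (α k + G.gain s.2 τ k) := by
  obtain _ | n := N
  · exact absurd rfl (NeZero.ne 0)
  simp only [dualPayoff, mul_add, Finset.sum_add_distrib, sum_playProb_mul_payoff]
  congr 1
  rw [sum_playProb_mul_succ]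
  refine Finset.sum_congr rfl fun k _ => congrArg _ ?_
  change ∑ a, (s.2.first k).1 a * ∑ b, τ.first.1 b * ∑ h, G.playProb _ _ _ h * α k = α k
  simp only [← Finset.sum_mul, sum_playProb, one_mul, τ.first.2.2, (s.2.first k).2.2]

end Game

/-! ### Separation and one-stage minimax -/

/-- A convex set of vectors none of which is negative in every coordinate is contained in a
half-space whose normal is a probability vector. -/
theorem exists_mem_stdSimplex_sum_mul_nonneg {I : Type*} [Fintype I] [Nonempty I]
    {C : Set (I → ℝ)} (hC : Convex ℝ C) (h : ∀ c ∈ C, ∃ i, 0 ≤ c i) :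
    ∃ l ∈ stdSimplex ℝ I, ∀ c ∈ C, 0 ≤ ∑ i, l i * c i := by
  classical
  obtain rfl | ⟨c₀, hc₀⟩ := C.eq_empty_or_nonempty
  · exact ⟨Pi.single (Classical.arbitrary I) 1, single_mem_stdSimplex ℝ _, by simp⟩
  set D : Set (I → ℝ) := Set.univ.pi fun _ => Set.Iio 0 with hD
  have hDc : Convex ℝ D := convex_pi fun _ _ => convex_Iio 0
  have hDo : IsOpen D := isOpen_set_pi Set.finite_univ fun _ _ => isOpen_Iio
  have hdisj : Disjoint D C := by
    rw [Set.disjoint_left]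
    intro c hcD hcC
    obtain ⟨i, hi⟩ := h c hcC
    exact absurd (hcD i trivial) (not_lt.2 hi)
  obtain ⟨f, u, hfD, hfC⟩ := geometric_hahn_banach_open hDc hDo hC hdisj
  set m : I → ℝ := fun i => f (Pi.single i 1) with hm
  have hf (c : I → ℝ) : f c = ∑ i, m i * c i := by
    conv_lhs => rw [pi_eq_sum_univ' c]
    simp only [map_sum, map_smul, smul_eq_mul, hm, mul_comm]
  -- The bound on the open negative orthant passes to its closure.
  have hneg (c : I → ℝ) (hc : ∀ i, c i ≤ 0) : f c ≤ u := by
    have ht : Filter.Tendsto (fun e : ℝ => f (c - fun _ => e)) (nhdsWithin 0 (Set.Ioi 0))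
        (nhds (f (c - fun _ => 0))) :=
      (Continuous.tendsto (by fun_prop) 0).mono_left nhdsWithin_le_nhds
    have h0 : (c - fun _ => (0 : ℝ)) = c := by ext; simp
    rw [h0] at ht
    refine le_of_tendsto ht (Filter.eventually_of_mem self_mem_nhdsWithin fun e he => ?_)
    refine (hfD _ fun i _ => ?_).le
    have := hc i
    simp only [Set.mem_Ioi] at he
    simp only [Pi.sub_apply, Set.mem_Iio]
    linarith
  have hu : 0 ≤ u := by simpa using hneg 0 fun _ => le_rfl
  have hm0 (i : I) : 0 ≤ m i := by
    by_contra! hi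
    -- If `m i < 0`, this nonpositive vector has `f`-value `u + 1`.
    have := hneg (Pi.single i ((u + 1) / m i)) fun j => by
      by_cases hj : j = i
      · subst hj
        simpa using div_nonpos_of_nonneg_of_nonpos (by linarith) hi.le
      · simp [hj]
    rw [hf, Finset.sum_eq_single i (fun j _ hj => by simp [hj]) (by simp)] at this
    simp only [Pi.single_eq_same] at this
    rw [mul_div_cancel₀ _ hi.ne] at this
    linarith
  -- The strict separation, with `c₀` as a point of `C`, excludes `f = 0`.
  have hS : 0 < ∑ i, m i := by
    have h1 := (hfD (fun _ => -1) fun i _ => by simp).trans_le (hfC c₀ hc₀)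
    have h2 := hfD (fun _ => -1) fun i _ => by simp
    refine (Finset.sum_nonneg fun i _ => hm0 i).lt_of_ne fun hz => ?_
    have hmz : ∀ i, m i = 0 := fun i =>
      (Finset.sum_eq_zero_iff_of_nonneg fun i _ => hm0 i).1 hz.symm i (Finset.mem_univ i)
    rw [hf, hf] at h1
    simp [hmz] at h1
  refine ⟨fun i => m i / ∑ j, m j, ⟨fun i => div_nonneg (hm0 i) hS.le, ?_⟩, fun c hc => ?_⟩
  · rw [← Finset.sum_div, div_self hS.ne']
  · have : ∑ i, m i / (∑ j, m j) * c i = f c / ∑ j, m j := by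
      rw [hf, Finset.sum_div]
      exact Finset.sum_congr rfl fun i _ => by ring
    rw [this]
    exact div_nonneg (hu.trans (hfC c hc)) hS.le

/-- A minimax theorem for behavior choices: if against every element `c` of a convex set some pure
choice `f : K → A` secures `v`, then some randomized choice secures `v` against all of them. -/
theorem exists_behavior_le_sum {K A : Type*} [Fintype K] [Fintype A] [Nonempty A] (p : K → ℝ)
    (v : ℝ) {C : Set (K → A → ℝ)} (hC : Convex ℝ C)
    (h : ∀ c ∈ C, ∃ f : K → A, v ≤ ∑ k, p k * c k (f k)) :
    ∃ x : K → ProbDist A, ∀ c ∈ C, v ≤ ∑ k, p k * ∑ a, (x k).1 a * c k a := by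
  classical
  have hC' : Convex ℝ ((fun c (f : K → A) => ∑ k, p k * c k (f k) - v) '' C) := by
    rintro _ ⟨c, hc, rfl⟩ _ ⟨d, hd, rfl⟩ s t hs ht hst
    refine ⟨s • c + t • d, hC hc hd hs ht hst, funext fun f => ?_⟩
    simp only [Pi.add_apply, Pi.smul_apply, smul_eq_mul, mul_add, Finset.sum_add_distrib, mul_sub,
      Finset.mul_sum]
    simp only [mul_left_comm (p _)]
    linear_combination v * hst
  obtain ⟨l, hl, hlC⟩ := exists_mem_stdSimplex_sum_mul_nonneg hC' (by
    rintro _ ⟨c, hc, rfl⟩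
    obtain ⟨f, hf⟩ := h c hc
    exact ⟨f, sub_nonneg.2 hf⟩)
  -- Separation gives a mixture `l` of pure choices. The payoff is a sum over `k` of terms in `f k`,
  -- so only the marginals of `l` matter.
  refine ⟨fun k => ⟨fun a => ∑ f : K → A, if f k = a then l f else 0,
    fun a => Finset.sum_nonneg fun f _ => ?_, ?_⟩, fun c hc => ?_⟩
  · split_ifs
    exacts [hl.1 f, le_rfl]
  · rw [Finset.sum_comm]
    simpa using hl.2
  · have h0 := hlC _ ⟨c, hc, rfl⟩
    simp only [mul_sub, Finset.sum_sub_distrib, ← Finset.sum_mul, hl.2, one_mul, sub_nonneg] at h0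
    refine h0.trans_eq ?_
    simp only [Finset.mul_sum, Finset.sum_mul]
    rw [Finset.sum_comm]
    refine Finset.sum_congr rfl fun k _ => ?_
    rw [Finset.sum_comm]
    refine Finset.sum_congr rfl fun f _ => ?_
    simp [mul_left_comm]

/-- The maximum of a linear function over the simplex is its largest coefficient. -/
theorem isMaxOver_sum_mul {I : Type*} [Fintype I] [Nonempty I] (c : I → ℝ) :
    IsMaxOver (fun (P : ProbDist I) r => r = ∑ i, P.1 i * c i)
      (Finset.univ.sup' Finset.univ_nonempty c) := by
  classical
  refine ⟨_, fun P => rfl, ?_, ?_⟩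
  · obtain ⟨i, -, hi⟩ := Finset.exists_mem_eq_sup' Finset.univ_nonempty c
    refine ⟨⟨Pi.single i 1, single_mem_stdSimplex ℝ i⟩, ?_⟩
    simp [hi, Pi.single_apply]
  · rintro _ ⟨P, rfl⟩
    calc ∑ i, P.1 i * c i
        ≤ ∑ i, P.1 i * Finset.univ.sup' Finset.univ_nonempty c :=
          Finset.sum_le_sum fun i _ =>
            mul_le_mul_of_nonneg_left (Finset.le_sup' c (Finset.mem_univ i)) (P.2.1 i)
      _ = _ := by rw [← Finset.sum_mul, P.2.2, one_mul]

/-- `isMaxOver_sum_mul` for distributions on a product, as a double sum. -/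
theorem isMaxOver_sum_sum_mul {K A : Type*} [Fintype K] [Fintype A] [Nonempty K] [Nonempty A]
    (c : K → A → ℝ) :
    IsMaxOver (fun (P : ProbDist (K × A)) r => r = ∑ k, ∑ a, P.1 (k, a) * c k a)
      (Finset.univ.sup' Finset.univ_nonempty fun i : K × A => c i.1 i.2) := by
  simpa only [Fintype.sum_prod_type] using isMaxOver_sum_mul fun i : K × A => c i.1 i.2

/-! ### Reply vectors and the saddle point -/

namespace Game

variable {K A B : Type*} [Fintype K] [Fintype B] (G : Game K A B)

/-- The expected payoff in state `k` when player 1 plays `a`, player 2 plays the mixed action `y`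
and the vector `u` is the payoff in the following state. -/
noncomputable def stageGain (y : B → ℝ) (a : A) (u : K → ℝ) (k : K) : ℝ :=
  ∑ b, G.M k a b * y b + ∑ k', G.Q a k k' * u k'

theorem stageGain_add_smul (s t : ℝ) (y y' : B → ℝ) (a : A) (u u' : K → ℝ) (k : K) :
    G.stageGain (s • y + t • y') a (s • u + t • u') k =
      s * G.stageGain y a u k + t * G.stageGain y' a u' k := by
  simp only [stageGain, Pi.add_apply, Pi.smul_apply, smul_eq_mul, mul_add, Finset.sum_add_distrib,
    Finset.mul_sum]
  simp only [mul_left_comm s, mul_left_comm t]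
  ring

theorem stageGain_mono (y : B → ℝ) (a : A) {u u' : K → ℝ} (h : u ≤ u') (k : K) :
    G.stageGain y a u k ≤ G.stageGain y a u' k :=
  add_le_add_right
    (Finset.sum_le_sum fun k' _ => mul_le_mul_of_nonneg_left (h k') ((G.Q_mem a k).1 k')) _

variable [Fintype A]

theorem gain_succ {n : ℕ} (σ : Strategy₁ K A B (n + 1)) (τ : Strategy₂ A B (n + 1)) (k : K) :
    G.gain σ τ k = ∑ a, (σ.first k).1 a *
      G.stageGain τ.first.1 a (∑ b, τ.first.1 b • G.gain (σ.tail k a b) (τ.tail a b)) k := by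
  rw [gain]
  refine Finset.sum_congr rfl fun a _ => congrArg _ ?_
  simp only [stageGain, mul_add, Finset.sum_add_distrib, Finset.mul_sum, Finset.sum_apply,
    Pi.smul_apply, smul_eq_mul]
  congr 1
  · exact Finset.sum_congr rfl fun b _ => mul_comm _ _
  · rw [Finset.sum_comm]
    exact Finset.sum_congr rfl fun k' _ => Finset.sum_congr rfl fun b _ => mul_left_comm _ _ _

variable [Nonempty A]

/-- The expected sum of the stage payoffs when the initial state is `k` and player 1 plays a best
reply. -/
noncomputable def bestGain : ∀ {N : ℕ}, Strategy₂ A B N → K → ℝ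
  | 0, _, _ => 0
  | _ + 1, τ, k => Finset.univ.sup' Finset.univ_nonempty fun a =>
      G.stageGain τ.first.1 a (∑ b, τ.first.1 b • bestGain (τ.tail a b)) k

theorem bestGain_succ_le_iff {n : ℕ} (τ : Strategy₂ A B (n + 1)) (k : K) (r : ℝ) :
    G.bestGain τ k ≤ r ↔
      ∀ a, G.stageGain τ.first.1 a (∑ b, τ.first.1 b • G.bestGain (τ.tail a b)) k ≤ r := by
  simp [bestGain, Finset.sup'_le_iff]

/-- A continuation that ignores `b` makes the average over `b` trivial. -/
theorem bestGain_cons_le_iff {n : ℕ} (y : ProbDist B) (τ : A → Strategy₂ A B n) (k : K) (r : ℝ) :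
    G.bestGain (Strategy₂.cons y fun a _ => τ a) k ≤ r ↔
      ∀ a, G.stageGain y.1 a (G.bestGain (τ a)) k ≤ r := by
  simp [bestGain_succ_le_iff, ← Finset.sum_smul, y.2.2]

theorem continuous_bestGain (N : ℕ) :
    Continuous (G.bestGain : Strategy₂ A B N → K → ℝ) := by
  induction N with
  | zero => exact continuous_const
  | succ n ih =>
    refine continuous_pi fun k => ?_
    simp only [bestGain]
    refine Continuous.finset_sup'_apply Finset.univ_nonempty fun a _ => ?_
    have h1 (b : B) : Continuous fun τ : Strategy₂ A B (n + 1) => τ.first.1 b :=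
      (continuous_apply b).comp (continuous_subtype_val.comp Strategy₂.continuous_first)
    have h2 (b : B) (k' : K) :
        Continuous fun τ : Strategy₂ A B (n + 1) => G.bestGain (τ.tail a b) k' :=
      (continuous_apply k').comp (ih.comp (Strategy₂.continuous_tail a b))
    simp only [stageGain, Finset.sum_apply, Pi.smul_apply, smul_eq_mul]
    fun_prop

theorem gain_le_bestGain {N : ℕ} (σ : Strategy₁ K A B N) (τ : Strategy₂ A B N) :
    G.gain σ τ ≤ G.bestGain τ := by
  induction N with
  | zero => exact fun k => le_rfl
  | succ n ih =>
    intro k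
    rw [gain_succ]
    calc _ ≤ ∑ a, (σ.first k).1 a * G.bestGain τ k := by
          refine Finset.sum_le_sum fun a _ => mul_le_mul_of_nonneg_left ?_ ((σ.first k).2.1 a)
          refine le_trans (G.stageGain_mono _ _ ?_ k) ((G.bestGain_succ_le_iff τ k _).1 le_rfl a)
          exact Finset.sum_le_sum fun b _ => smul_le_smul_of_nonneg_left (ih _ _) (τ.first.2.1 b)
      _ = _ := by rw [← Finset.sum_mul, (σ.first k).2.2, one_mul]

/-- The vectors that player 2 can guarantee not to exceed, whatever the initial state. -/
def achievable (N : ℕ) : Set (K → ℝ) := {u | ∃ τ : Strategy₂ A B N, G.bestGain τ ≤ u}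

/-- By induction, the average over `b` of the continuation vectors is itself achievable, so a first
stage reduces to a pair `(y, u)` with `u a` achievable. The stage payoff is jointly linear in such
pairs, which can thus be mixed directly. -/
theorem convex_achievable (N : ℕ) : Convex ℝ (G.achievable N) := by
  induction N with
  | zero =>
    rintro u ⟨τ, hu⟩ u' ⟨_, hu'⟩ s t hs ht -
    exact ⟨τ, add_nonneg (smul_nonneg hs hu) (smul_nonneg ht hu')⟩
  | succ n ih =>
    rintro u ⟨τ, hu⟩ u' ⟨τ', hu'⟩ s t hs ht hst
    have hmem (τ : Strategy₂ A B (n + 1)) (a : A) :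
        ∑ b, τ.first.1 b • G.bestGain (τ.tail a b) ∈ G.achievable n :=
      ih.sum_mem (fun b _ => τ.first.2.1 b) τ.first.2.2 fun b _ => ⟨_, le_rfl⟩
    choose ρ hρ using fun a => ih (hmem τ a) (hmem τ' a) hs ht hst
    refine ⟨Strategy₂.cons ⟨_, convex_stdSimplex ℝ B τ.first.2 τ'.first.2 hs ht hst⟩
      fun a _ => ρ a, fun k => ?_⟩
    rw [bestGain_cons_le_iff]
    intro a
    refine (G.stageGain_mono _ a (hρ a) k).trans ?_
    rw [stageGain_add_smul]
    exact add_le_add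
      (mul_le_mul_of_nonneg_left ((G.bestGain_succ_le_iff τ k _).1 (hu k) a) hs)
      (mul_le_mul_of_nonneg_left ((G.bestGain_succ_le_iff τ' k _).1 (hu' k) a) ht)

theorem exists_bestGain_tail_le {n : ℕ} (τ : Strategy₂ A B (n + 1)) (a : A) :
    ∃ ρ : Strategy₂ A B n, G.bestGain ρ ≤ ∑ b, τ.first.1 b • G.bestGain (τ.tail a b) :=
  (G.convex_achievable n).sum_mem (fun b _ => τ.first.2.1 b) τ.first.2.2 fun _ _ => ⟨_, le_rfl⟩

variable [Nonempty B]

/-- Induction on the horizon: minimax against the convex set of stage payoffs fixes the first stage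
of player 1, and the induction hypothesis supplies a continuation for each `a`. The weights `p` are
not normalized, so that no conditional probability is needed. -/
theorem exists_forall_le_sum_mul_gain (N : ℕ) (p : K → ℝ) (hp : 0 ≤ p) (v : ℝ)
    (h : ∀ τ : Strategy₂ A B N, v ≤ ∑ k, p k * G.bestGain τ k) :
    ∃ σ : Strategy₁ K A B N, ∀ τ, v ≤ ∑ k, p k * G.gain σ τ k := by
  induction N generalizing p v with
  | zero => exact ⟨fun t => t.elim0, h⟩
  | succ n ih =>
    let C : Set (K → A → ℝ) := {c | ∃ y ∈ stdSimplex ℝ B, ∃ u : A → K → ℝ,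
      (∀ a, u a ∈ G.achievable n) ∧ c = fun k a => G.stageGain y a (u a) k}
    have hC : Convex ℝ C := by
      rintro _ ⟨y, hy, u, hu, rfl⟩ _ ⟨y', hy', u', hu', rfl⟩ s t hs ht hst
      refine ⟨_, convex_stdSimplex ℝ B hy hy' hs ht hst, s • u + t • u',
        fun a => G.convex_achievable n (hu a) (hu' a) hs ht hst, ?_⟩
      funext k a
      exact (G.stageGain_add_smul s t y y' a (u a) (u' a) k).symm
    obtain ⟨x, hx⟩ := exists_behavior_le_sum p v hC (by
      rintro _ ⟨y, hy, u, hu, rfl⟩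
      choose τ hτ using hu
      choose f hf using fun k => Finite.exists_max fun a => G.stageGain y a (u a) k
      refine ⟨f, (h (Strategy₂.cons ⟨y, hy⟩ fun a _ => τ a)).trans
        (Finset.sum_le_sum fun k _ => mul_le_mul_of_nonneg_left ?_ (hp k))⟩
      rw [bestGain_cons_le_iff]
      exact fun a => (G.stageGain_mono y a (hτ a) k).trans (hf k a))
    -- The joint weight of playing `a` and moving to `k'`; it does not involve `b`, so one
    -- continuation per `a` suffices.
    let q : A → K → ℝ := fun a k' => ∑ k, p k * (x k).1 a * G.Q a k k'
    have hq (a : A) : 0 ≤ q a := fun k' => Finset.sum_nonneg fun k _ =>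
      mul_nonneg (mul_nonneg (hp k) ((x k).2.1 a)) ((G.Q_mem a k).1 k')
    have hmin (a : A) : ∃ ρ : Strategy₂ A B n, ∀ τ : Strategy₂ A B n,
        ∑ k, q a k * G.bestGain ρ k ≤ ∑ k, q a k * G.bestGain τ k := by
      have hc := G.continuous_bestGain n
      obtain ⟨ρ, -, hρ⟩ := isCompact_univ.exists_isMinOn Set.univ_nonempty
        (f := fun τ : Strategy₂ A B n => ∑ k, q a k * G.bestGain τ k)
        (Continuous.continuousOn (by fun_prop))
      exact ⟨ρ, fun τ => hρ (Set.mem_univ τ)⟩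
    choose ρ hρ using hmin
    choose σ hσ using fun a => ih (q a) (hq a) _ (hρ a)
    have hsum (y : B → ℝ) (u : A → K → ℝ) :
        ∑ k, p k * ∑ a, (x k).1 a * G.stageGain y a (u a) k =
          ∑ k, p k * ∑ a, (x k).1 a * ∑ b, G.M k a b * y b + ∑ a, ∑ k', q a k' * u a k' := by
      simp only [stageGain, mul_add, Finset.sum_add_distrib, q, Finset.mul_sum, Finset.sum_mul]
      congr 1
      rw [Finset.sum_comm]
      refine Finset.sum_congr rfl fun a _ => ?_
      rw [Finset.sum_comm]
      exact Finset.sum_congr rfl fun k' _ => Finset.sum_congr rfl fun k _ => by ring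
    refine ⟨Strategy₁.cons x fun _ a _ => σ a, fun τ => ?_⟩
    refine (hx _ ⟨τ.first.1, τ.first.2, fun a => G.bestGain (ρ a), fun a => ⟨_, le_rfl⟩,
      rfl⟩).trans ?_
    simp only [gain_succ, Strategy₁.first_cons, Strategy₁.tail_cons]
    rw [hsum, hsum τ.first.1 fun a => ∑ b, τ.first.1 b • G.gain (σ a) (τ.tail a b)]
    refine add_le_add_right (Finset.sum_le_sum fun a _ => ?_) _
    calc ∑ k, q a k * G.bestGain (ρ a) k
        = ∑ b, τ.first.1 b * ∑ k, q a k * G.bestGain (ρ a) k := by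
          rw [← Finset.sum_mul, τ.first.2.2, one_mul]
      _ ≤ ∑ b, τ.first.1 b * ∑ k, q a k * G.gain (σ a) (τ.tail a b) k :=
          Finset.sum_le_sum fun b _ => mul_le_mul_of_nonneg_left (hσ a _) (τ.first.2.1 b)
      _ = _ := by
          simp only [Finset.sum_apply, Pi.smul_apply, smul_eq_mul, Finset.mul_sum]
          rw [Finset.sum_comm]
          exact Finset.sum_congr rfl fun k _ => Finset.sum_congr rfl fun b _ =>
            mul_left_comm _ _ _

variable [Nonempty K]

/-- By compactness some `τ` minimizes the largest coordinate of `α` plus the reply vector.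
Minimality says no achievable vector falls below that level in every coordinate, so separation
yields the initial law. -/
theorem exists_saddle (N : ℕ) (α : K → ℝ) :
    ∃ (v : ℝ) (s : ProbDist K × Strategy₁ K A B N) (τ : Strategy₂ A B N),
      (∀ ρ, v ≤ ∑ k, s.1.1 k * (α k + G.gain s.2 ρ k)) ∧ ∀ k, α k + G.bestGain τ k ≤ v := by
  have hc := G.continuous_bestGain N
  let m : Strategy₂ A B N → ℝ := fun τ =>
    Finset.univ.sup' Finset.univ_nonempty fun k => α k + G.bestGain τ k
  obtain ⟨τ, -, hτ⟩ := isCompact_univ.exists_isMinOn Set.univ_nonempty (f := m)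
    (Continuous.continuousOn
      (Continuous.finset_sup'_apply Finset.univ_nonempty fun k _ => by fun_prop))
  let C : Set (K → ℝ) := (fun u k => α k + u k - m τ) '' G.achievable N
  have hC : Convex ℝ C := by
    rintro _ ⟨u, hu, rfl⟩ _ ⟨u', hu', rfl⟩ s t hs ht hst
    refine ⟨_, G.convex_achievable N hu hu' hs ht hst, funext fun k => ?_⟩
    simp only [Pi.add_apply, Pi.smul_apply, smul_eq_mul]
    linear_combination (m τ - α k) * hst
  obtain ⟨p, hp, hpC⟩ := exists_mem_stdSimplex_sum_mul_nonneg hC (by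
    rintro _ ⟨u, ⟨ρ, hρ⟩, rfl⟩
    obtain ⟨k, -, hk⟩ := Finset.exists_mem_eq_sup' (Finset.univ_nonempty (α := K))
      fun k => α k + G.bestGain ρ k
    have h1 : m τ ≤ m ρ := hτ (Set.mem_univ ρ)
    have h2 := hρ k
    simp only [m] at h1
    exact ⟨k, by simp only [m]; linarith⟩)
  obtain ⟨σ, hσ⟩ := G.exists_forall_le_sum_mul_gain N p hp.1 (m τ - ∑ k, p k * α k) fun ρ => by
    have := hpC _ ⟨_, ⟨ρ, le_rfl⟩, rfl⟩
    simp only [mul_sub, mul_add, Finset.sum_sub_distrib, Finset.sum_add_distrib,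
      ← Finset.sum_mul, hp.2, one_mul] at this
    linarith
  refine ⟨m τ, (⟨p, hp⟩, σ), τ, fun ρ => ?_, fun k => ?_⟩
  · have := hσ ρ
    simp only [mul_add, Finset.sum_add_distrib]
    linarith
  · exact Finset.le_sup' (fun k => α k + G.bestGain τ k) (Finset.mem_univ k)

end Game

/-! ### Continuity of the payoff and attained extrema -/

namespace Game

variable {K A B : Type*} [Fintype K] [Fintype A] [Fintype B] (G : Game K A B)

theorem continuous_gain_left {N : ℕ} (τ : Strategy₂ A B N) (k : K) :
    Continuous fun σ : Strategy₁ K A B N => G.gain σ τ k := by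
  induction N generalizing k with
  | zero => exact continuous_const
  | succ n ih =>
    simp only [gain]
    have h1 (a : A) : Continuous fun σ : Strategy₁ K A B (n + 1) => (σ.first k).1 a :=
      (continuous_apply a).comp (continuous_subtype_val.comp (by
        unfold Strategy₁.first
        fun_prop))
    have h2 (a : A) (b : B) (k' : K) :
        Continuous fun σ : Strategy₁ K A B (n + 1) => G.gain (σ.tail k a b) (τ.tail a b) k' :=
      (ih (τ.tail a b) k').comp (by
        unfold Strategy₁.tail
        fun_prop)
    fun_prop

theorem continuous_gain_right {N : ℕ} (σ : Strategy₁ K A B N) (k : K) :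
    Continuous fun τ : Strategy₂ A B N => G.gain σ τ k := by
  induction N generalizing k with
  | zero => exact continuous_const
  | succ n ih =>
    simp only [gain]
    have h1 (b : B) : Continuous fun τ : Strategy₂ A B (n + 1) => τ.first.1 b :=
      (continuous_apply b).comp (continuous_subtype_val.comp Strategy₂.continuous_first)
    have h2 (a : A) (b : B) (k' : K) :
        Continuous fun τ : Strategy₂ A B (n + 1) => G.gain (σ.tail k a b) (τ.tail a b) k' :=
      (ih (σ.tail k a b) k').comp (Strategy₂.continuous_tail a b)
    fun_prop

theorem continuous_dualPayoff_left (N : ℕ) [NeZero N] (α : K → ℝ) (τ : Strategy₂ A B N) :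
    Continuous fun s => G.dualPayoff N α s τ := by
  simp only [dualPayoff_eq]
  refine continuous_finsetSum _ fun k _ => Continuous.mul ?_ (continuous_const.add ?_)
  · exact (continuous_apply k).comp (continuous_subtype_val.comp continuous_fst)
  · exact (G.continuous_gain_left τ k).comp continuous_snd

theorem continuous_dualPayoff_right (N : ℕ) [NeZero N] (α : K → ℝ)
    (s : ProbDist K × Strategy₁ K A B N) :
    Continuous fun τ => G.dualPayoff N α s τ := by
  simp only [dualPayoff_eq]
  exact continuous_finsetSum _ fun k _ =>
    continuous_const.mul (continuous_const.add (G.continuous_gain_right s.2 k))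

end Game

/-- A continuous real function on a nonempty compact space attains its minimum. -/
theorem exists_isLeast_range {X : Type*} [TopologicalSpace X] [CompactSpace X] [Nonempty X]
    {f : X → ℝ} (hf : Continuous f) : ∃ v, IsLeast (Set.range f) v := by
  obtain ⟨x, -, hx⟩ := isCompact_univ.exists_isMinOn Set.univ_nonempty hf.continuousOn
  exact ⟨f x, ⟨x, rfl⟩, by rintro _ ⟨y, rfl⟩; exact hx (Set.mem_univ y)⟩

/-- A continuous real function on a nonempty compact space attains its maximum. -/
theorem exists_isGreatest_range {X : Type*} [TopologicalSpace X] [CompactSpace X] [Nonempty X]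
    {f : X → ℝ} (hf : Continuous f) : ∃ v, IsGreatest (Set.range f) v := by
  obtain ⟨x, -, hx⟩ := isCompact_univ.exists_isMaxOn Set.univ_nonempty hf.continuousOn
  exact ⟨f x, ⟨x, rfl⟩, by rintro _ ⟨y, rfl⟩; exact hx (Set.mem_univ y)⟩

/-! ### The dual value and its recursion -/

namespace Game

variable {K A B : Type*} [Fintype K] [Fintype A] [Fintype B] [Nonempty A] (G : Game K A B)

theorem dualPayoff_le_of_bestGain_le {N : ℕ} [NeZero N] {α : K → ℝ} {τ : Strategy₂ A B N} {r : ℝ}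
    (h : ∀ k, α k + G.bestGain τ k ≤ r) (s : ProbDist K × Strategy₁ K A B N) :
    G.dualPayoff N α s τ ≤ r := by
  rw [dualPayoff_eq]
  calc _ ≤ ∑ k, s.1.1 k * r := Finset.sum_le_sum fun k _ =>
        mul_le_mul_of_nonneg_left ((add_le_add_right (G.gain_le_bestGain s.2 τ k) _).trans (h k))
          (s.1.2.1 k)
    _ = r := by rw [← Finset.sum_mul, s.1.2.2, one_mul]

variable [Nonempty K]

/-- The largest payoff in the dual game when player 2 plays `y` at the first stage and then
`τ a` after the action `a` of player 1. -/
noncomputable def firstStageMax {n : ℕ} (α : K → ℝ) (y : ProbDist B) (τ : A → Strategy₂ A B n) :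
    ℝ :=
  Finset.univ.sup' Finset.univ_nonempty fun i : K × A =>
    α i.1 + G.stageGain y.1 i.2 (G.bestGain (τ i.2)) i.1

theorem firstStageMax_le_iff {n : ℕ} {α : K → ℝ} {y : ProbDist B} {τ : A → Strategy₂ A B n}
    {r : ℝ} : G.firstStageMax α y τ ≤ r ↔
      ∀ k a, α k + G.stageGain y.1 a (G.bestGain (τ a)) k ≤ r := by
  simp [firstStageMax, Finset.sup'_le_iff]

theorem continuous_firstStageMax {n : ℕ} (α : K → ℝ) (y : ProbDist B) :
    Continuous fun τ : A → Strategy₂ A B n => G.firstStageMax α y τ := by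
  refine Continuous.finset_sup'_apply Finset.univ_nonempty fun i _ => ?_
  have h (k : K) : Continuous fun τ : A → Strategy₂ A B n => G.bestGain (τ i.2) k :=
    (continuous_apply k).comp ((G.continuous_bestGain n).comp (continuous_apply i.2))
  simp only [stageGain]
  fun_prop

/-- With no stage left reply vectors vanish, so the choice of `τ` is immaterial. -/
theorem isMaxOver_of_isLeast_firstStageMax_zero (α : K → ℝ) (y : ProbDist B) {v : ℝ}
    (hv : IsLeast (Set.range fun τ : A → Strategy₂ A B 0 => G.firstStageMax α y τ) v) :
    IsMaxOver (fun (P : ProbDist (K × A)) r =>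
      r = ∑ k : K, ∑ a : A, P.1 (k, a) * ((∑ b : B, G.M k a b * y.1 b) + α k)) v := by
  obtain ⟨τ, rfl⟩ := hv.1
  have h : G.firstStageMax α y τ = Finset.univ.sup' Finset.univ_nonempty fun i : K × A =>
      (∑ b : B, G.M i.1 i.2 b * y.1 b) + α i.1 := by
    simp [firstStageMax, stageGain, bestGain, add_comm]
  simp only [h]
  exact isMaxOver_sum_sum_mul fun k a => (∑ b : B, G.M k a b * y.1 b) + α k

variable [Nonempty B]

/-- The saddle point gives the value; compactness is needed besides because the inner extrema must
be attained at non-optimal strategies too. -/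
theorem exists_isDualValue (N : ℕ) [NeZero N] (α : K → ℝ) :
    ∃ v, G.IsDualValue N α v ∧ G.dualValue N α = v ∧
      ∀ r, v ≤ r ↔ ∃ τ : Strategy₂ A B N, ∀ k, α k + G.bestGain τ k ≤ r := by
  obtain ⟨v, s, τ, hs, hτ⟩ := G.exists_saddle N α
  simp only [← dualPayoff_eq] at hs
  have hle := G.dualPayoff_le_of_bestGain_le hτ
  choose m hm using fun s => exists_isLeast_range (G.continuous_dualPayoff_right N α s)
  choose M hM using fun τ => exists_isGreatest_range (G.continuous_dualPayoff_left N α τ)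
  have hm_le (s) : m s ≤ v := ((hm s).2 ⟨τ, rfl⟩).trans (hle s)
  have hle_M (ρ) : v ≤ M ρ := (hs ρ).trans ((hM ρ).2 ⟨s, rfl⟩)
  have hms : m s = v := (hm_le s).antisymm <| by
    obtain ⟨ρ, hρ⟩ := (hm s).1
    exact hρ ▸ hs ρ
  have hMτ : M τ = v := by
    refine le_antisymm ?_ (hle_M τ)
    obtain ⟨s', hs'⟩ := (hM τ).1
    exact hs' ▸ hle s'
  have hgreatest : IsGreatest (Set.range m) v :=
    ⟨⟨s, hms⟩, by rintro _ ⟨s', rfl⟩; exact hm_le s'⟩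
  refine ⟨v, ⟨⟨m, fun s => ⟨_, fun ρ => rfl, hm s⟩, hgreatest⟩,
    ⟨M, fun ρ => ⟨_, fun s => rfl, hM ρ⟩, ⟨τ, hMτ⟩, by rintro _ ⟨ρ, rfl⟩; exact hle_M ρ⟩⟩, ?_,
    fun r => ⟨fun hr => ⟨τ, fun k => (hτ k).trans hr⟩, fun ⟨ρ, hρ⟩ =>
      (hs ρ).trans (G.dualPayoff_le_of_bestGain_le hρ s)⟩⟩
  have hinf (s) : ⨅ ρ, G.dualPayoff N α s ρ = m s := (hm s).csInf_eq
  simp only [dualValue, hinf]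
  exact hgreatest.csSup_eq

theorem isDualValue_dualValue (N : ℕ) [NeZero N] (α : K → ℝ) :
    G.IsDualValue N α (G.dualValue N α) := by
  obtain ⟨v, hv, h, -⟩ := G.exists_isDualValue N α
  rwa [h]

theorem dualValue_le_iff {N : ℕ} [NeZero N] {α : K → ℝ} {r : ℝ} :
    G.dualValue N α ≤ r ↔ ∃ τ : Strategy₂ A B N, ∀ k, α k + G.bestGain τ k ≤ r := by
  obtain ⟨v, -, h, hr⟩ := G.exists_isDualValue N α
  rw [h, hr]

theorem dualValue_le_firstStageMax {n : ℕ} (α : K → ℝ) (y : ProbDist B)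
    (τ : A → Strategy₂ A B n) : G.dualValue (n + 1) α ≤ G.firstStageMax α y τ := by
  refine G.dualValue_le_iff.2 ⟨Strategy₂.cons y fun a _ => τ a, fun k => ?_⟩
  rw [← le_sub_iff_add_le', bestGain_cons_le_iff]
  exact fun a => le_sub_iff_add_le'.2 (G.firstStageMax_le_iff.1 le_rfl k a)

theorem exists_firstStageMax_le (n : ℕ) (α : K → ℝ) :
    ∃ (y : ProbDist B) (τ : A → Strategy₂ A B n),
      G.firstStageMax α y τ ≤ G.dualValue (n + 1) α := by
  obtain ⟨τ, hτ⟩ := G.dualValue_le_iff.1 (le_refl (G.dualValue (n + 1) α))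
  choose ρ hρ using G.exists_bestGain_tail_le τ
  refine ⟨τ.first, ρ, G.firstStageMax_le_iff.2 fun k a => ?_⟩
  exact (add_le_add_right ((G.stageGain_mono _ a (hρ a) k).trans
    ((G.bestGain_succ_le_iff τ k _).1 le_rfl a)) _).trans (hτ k)

theorem exists_isLeast_firstStageMax (n : ℕ) (α : K → ℝ) :
    ∃ v : ProbDist B → ℝ,
      (∀ y, IsLeast (Set.range fun τ : A → Strategy₂ A B n => G.firstStageMax α y τ) (v y)) ∧
      IsLeast (Set.range v) (G.dualValue (n + 1) α) := by
  choose v hv using fun y =>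
    exists_isLeast_range (G.continuous_firstStageMax (n := n) α y)
  have hle (y) : G.dualValue (n + 1) α ≤ v y := by
    obtain ⟨τ, hτ⟩ := (hv y).1
    exact hτ ▸ G.dualValue_le_firstStageMax α y τ
  obtain ⟨y, τ, h⟩ := G.exists_firstStageMax_le n α
  exact ⟨v, hv, ⟨y, (((hv y).2 ⟨τ, rfl⟩).trans h).antisymm (hle y)⟩,
    by rintro _ ⟨y, rfl⟩; exact hle y⟩

/-- Exchanges continuation strategies for vectors `β a` at a fixed `y`. -/
theorem isMinOver_isMaxOver_vector {n : ℕ} [NeZero n] (α : K → ℝ) (y : ProbDist B) {v : ℝ}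
    (hv : IsLeast (Set.range fun τ : A → Strategy₂ A B n => G.firstStageMax α y τ) v) :
    IsMinOver (fun β : A → K → ℝ =>
      IsMaxOver fun (P : ProbDist (K × A)) r =>
        r = ∑ k : K, ∑ a : A, P.1 (k, a) *
          ((∑ b : B, G.M k a b * y.1 b) + α k - (∑ k' : K, G.Q a k k' * β a k')
            + G.dualValue n (β a))) v := by
  let c (β : A → K → ℝ) (i : K × A) : ℝ :=
    (∑ b : B, G.M i.1 i.2 b * y.1 b) + α i.1 - (∑ k' : K, G.Q i.2 i.1 k' * β i.2 k')
      + G.dualValue n (β i.2)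
  have hle (β : A → K → ℝ) : v ≤ Finset.univ.sup' Finset.univ_nonempty (c β) := by
    choose τ hτ using fun a => G.dualValue_le_iff.1 (le_refl (G.dualValue n (β a)))
    refine (hv.2 ⟨τ, rfl⟩).trans (G.firstStageMax_le_iff.2 fun k a => ?_)
    refine le_trans ?_ (Finset.le_sup' (c β) (Finset.mem_univ (k, a)))
    -- A `τ a` optimal in the dual game at `β a` has reply vector at most `w_n(β a) - β a`; rows of
    -- `Q` sum to one, so the constant comes out of the transition sum.
    have := G.stageGain_mono y.1 a (u := G.bestGain (τ a))
      (u' := fun k' => G.dualValue n (β a) - β a k') (fun k' => by linarith [hτ a k']) k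
    simp only [stageGain, mul_sub, Finset.sum_sub_distrib, ← Finset.sum_mul, (G.Q_mem a k).2,
      one_mul] at this
    simp only [stageGain, c]
    linarith
  have hatt : ∃ β, Finset.univ.sup' Finset.univ_nonempty (c β) ≤ v := by
    obtain ⟨τ, hτ⟩ := hv.1
    -- This `β` cancels the reply vector, so `τ a` itself shows `w_n(β a) ≤ 0`.
    refine ⟨fun a k => -G.bestGain (τ a) k, Finset.sup'_le _ _ fun i _ => ?_⟩
    have h1 : G.dualValue n (fun k => -G.bestGain (τ i.2) k) ≤ 0 :=
      G.dualValue_le_iff.2 ⟨τ i.2, fun k => by simp⟩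
    have h2 := G.firstStageMax_le_iff.1 hτ.le i.1 i.2
    simp only [stageGain] at h2
    simp only [c, mul_neg, Finset.sum_neg_distrib]
    linarith
  obtain ⟨β, hβ⟩ := hatt
  refine ⟨fun β => Finset.univ.sup' Finset.univ_nonempty (c β),
    fun β => isMaxOver_sum_sum_mul fun k a => c β (k, a), ⟨β, hβ.antisymm (hle β)⟩, ?_⟩
  rintro _ ⟨β, rfl⟩
  exact hle β

end Game

end AsymGame

theorem mainTheorem8 {K A B : Type*} [Fintype K] [Fintype A] [Fintype B]
    [Nonempty K] [Nonempty A] [Nonempty B] (G : Game K A B) :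
    -- every dual game has a value, namely `dualValue`
    (∀ (N : ℕ) [NeZero N] (α : K → ℝ), G.IsDualValue N α (G.dualValue N α)) ∧
    -- the recursive formula
    (∀ (n : ℕ) [NeZero n] (α : K → ℝ),
      IsMinOver (fun y : ProbDist B =>
        IsMinOver fun β : A → K → ℝ =>
          IsMaxOver fun (P : ProbDist (K × A)) r =>
            r = ∑ k : K, ∑ a : A, P.1 (k, a) *
              ((∑ b : B, G.M k a b * y.1 b) + α k - (∑ k' : K, G.Q a k k' * β a k')
                + G.dualValue n (β a)))
        (G.dualValue (n + 1) α)) ∧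
    -- the formula for the one-stage game
    (∀ α : K → ℝ,
      IsMinOver (fun y : ProbDist B =>
        IsMaxOver fun (P : ProbDist (K × A)) r =>
          r = ∑ k : K, ∑ a : A, P.1 (k, a) * ((∑ b : B, G.M k a b * y.1 b) + α k))
        (G.dualValue 1 α)) := by
  refine ⟨fun N _ α => G.isDualValue_dualValue N α, fun n _ α => ?_, fun α => ?_⟩
  · obtain ⟨v, hv, h⟩ := G.exists_isLeast_firstStageMax n α
    exact ⟨v, fun y => G.isMinOver_isMaxOver_vector α y (hv y), h⟩
  · obtain ⟨v, hv, h⟩ := G.exists_isLeast_firstStageMax 0 α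
    exact ⟨v, fun y => G.isMaxOver_of_isLeast_firstStageMax_zero α y (hv y), h⟩
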